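/- For $n\ge 2$ let $B_n=\langle s_1,\dots,s_{n-1}\mid s_is_{i+1}s_i=s_{i+1}s_is_{i+1}\ (1\le i\le n-2),\ s_is_j=s_js_i\ (|i-j|\ge 2)\rangle$ be the braid group, let $P_n$ be the pure braid group, i.e. the kernel of the homomorphism $B_n\to S_n$, $s_i\mapsto(i\ i{+}1)$, and let $B_n$ act on the free group $\mathbb F_n=\langle x_1,\dots,x_n\rangle$ by Artin's representation $\alpha\colon B_n\to\operatorname{Aut}\mathbb F_n$, $$\alpha(s_i)(x_i)=x_{i+1},\qquad \alpha(s_i)(x_{i+1})=x_{i+1}^{-1}x_ix_{i+1},\qquad \alpha(s_i)(x_j)=x_j\ \ (j\ne i,i+1);$$ $P_n$ acts by restriction. Let $\mathbb T$ be the circle group. For an action $\alpha$ of a group $K$ on a group $H$, let $Z^1(K,\operatorname{Hom}(H,\mathbb T))$ be the group, under pointwise multiplication, of all functions $\varphi\colon K\times H\to\mathbb T$ with $\varphi(ab,x)=\varphi(a,\alpha_b(x))\varphi(b,x)$ and $\varphi(a,xy)=\varphi(a,x)\varphi(a,y)$ for all $a,b\in K$, $x,y\in H$; let $B^1(K,\operatorname{Hom}(H,\mathbb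 T))$ be its subgroup of functions $(a,x)\mapsto f(\alpha_a(x))\overline{f(x)}$ with $f\in\operatorname{Hom}(H,\mathbb T)$; and put $H^1=Z^1/B^1$. (1) For every $n\ge2$ and $\varphi\in Z^1(B_n,\operatorname{Hom}(\mathbb F_n,\mathbb T))$, the value $\mu_1(\varphi)=\varphi(s_i,x_i)\varphi(s_i,x_{i+1})$ does not depend on $i\in\{1,\dots,n-1\}$; and if $n\ge3$, the value $\mu_2(\varphi)=\varphi(s_i,x_j)$ does not depend on $i\in\{1,\dots,n-1\}$ and $j\in\{1,\dots,n\}\setminus\{i,i+1\}$. For $n=2$ the map $\varphi\mapsto\mu_1(\varphi)$ induces a group isomorphism $H^1(B_2,\operatorname{Hom}(\mathbb F_2,\mathbb T))\simeq\mathbb T$, and for every $n\ge3$ the map $\varphi\mapsto(\mu_1(\varphi),\mu_2(\varphi))$ induces a group isomorphism $H^1(B_n,\operatorname{Hom}(\mathbb F_n,\mathbb T))\simeq\mathbb T^2$. (2) For every $n\ge2$, the action of $P_n$ on $\operatorname{Hom}(\mathbb F_n,\mathbb T)$ is trivial, that is, $f\circ\alpha_a=f$ for all $a\in P_n$ and $f\in\operatorname{Hom}(\mathbb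 F_n,\mathbb T)$. Hence $B^1(P_n,\operatorname{Hom}(\mathbb F_n,\mathbb T))$ is trivial, and $$H^1(P_n,\operatorname{Hom}(\mathbb F_n,\mathbb T))=Z^1(P_n,\operatorname{Hom}(\mathbb F_n,\mathbb T))=\operatorname{Hom}(P_n,\operatorname{Hom}(\mathbb F_n,\mathbb T))\simeq\mathbb T^{\frac12n(n-1)\cdot n}$$ as groups. -/

import Mathlib

namespace ArtinBraid

set_option linter.unusedSimpArgs false

/-- The index `i` (counted from `0`) of the generator `s_i`, as a strand. -/
def lo {n : ℕ} (i : Fin (n - 1)) : Fin n := ⟨i, by omega⟩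

/-- The index `i + 1`, as a strand. -/
def hi {n : ℕ} (i : Fin (n - 1)) : Fin n := ⟨i + 1, by omega⟩

/-- The braid relations `s_i s_{i+1} s_i = s_{i+1} s_i s_{i+1}`, and `s_i s_j = s_j s_i`
for `|i - j| ≥ 2`. -/
def braidRels (n : ℕ) : Set (FreeGroup (Fin (n - 1))) :=
  {r | ∃ i j : Fin (n - 1), (j : ℕ) = i + 1 ∧
      r = (FreeGroup.of i * FreeGroup.of j * FreeGroup.of i) *
        (FreeGroup.of j * FreeGroup.of i * FreeGroup.of j)⁻¹} ∪
  {r | ∃ i j : Fin (n - 1), ((i : ℕ) + 2 ≤ j ∨ (j : ℕ) + 2 ≤ i) ∧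
      r = (FreeGroup.of i * FreeGroup.of j) * (FreeGroup.of j * FreeGroup.of i)⁻¹}

/-- The braid group `B_n` on `n` strands. -/
abbrev BraidGroup (n : ℕ) : Type := PresentedGroup (braidRels n)

/-- The standard generator `s_i` of `B_n`. -/
def s {n : ℕ} (i : Fin (n - 1)) : BraidGroup n := PresentedGroup.of i

/-- The free generator `x_j` of `F_n`. -/
abbrev x {n : ℕ} (j : Fin n) : FreeGroup (Fin n) := FreeGroup.of j

/-- A family of elements satisfying the braid relations defines a homomorphism on `B_n`. -/
theorem lift_rels {n : ℕ} {G : Type*} [Group G] (g : Fin (n - 1) → G)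
    (h1 : ∀ i j : Fin (n - 1), (j : ℕ) = i + 1 → g i * g j * g i = g j * g i * g j)
    (h2 : ∀ i j : Fin (n - 1), (i : ℕ) + 2 ≤ j → g i * g j = g j * g i) :
    ∀ r ∈ braidRels n, FreeGroup.lift g r = 1 := by
  rintro r (⟨i, j, hij, rfl⟩ | ⟨i, j, hij | hij, rfl⟩)
  · simp only [map_mul, map_inv, FreeGroup.lift_apply_of, mul_inv_eq_one]
    exact h1 i j hij
  · simp only [map_mul, map_inv, FreeGroup.lift_apply_of, mul_inv_eq_one]
    exact h2 i j hij
  · simp only [map_mul, map_inv, FreeGroup.lift_apply_of, mul_inv_eq_one]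
    exact (h2 j i hij).symm

/-- The natural homomorphism `B_n → S_n`, sending `s_i` to the transposition `(i, i+1)`. -/
def toPerm (n : ℕ) : BraidGroup n →* Equiv.Perm (Fin n) :=
  PresentedGroup.toGroup (f := fun i : Fin (n - 1) => Equiv.swap (lo i) (hi i)) <| by
    refine lift_rels _ ?_ ?_
    · intro i j hij
      ext k
      simp only [Equiv.Perm.mul_apply, Equiv.swap_apply_def, lo, hi, Fin.ext_iff]
      grind
    · intro i j hij
      ext k
      simp only [Equiv.Perm.mul_apply, Equiv.swap_apply_def, lo, hi, Fin.ext_iff]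
      grind

/-- The pure braid group `P_n`. -/
def PureBraidGroup (n : ℕ) : Subgroup (BraidGroup n) := (toPerm n).ker

/-- The endomorphism `x_i ↦ x_{i+1}`, `x_{i+1} ↦ x_{i+1}⁻¹ x_i x_{i+1}`, `x_j ↦ x_j` else. -/
def artinHom {n : ℕ} (i : Fin (n - 1)) : FreeGroup (Fin n) →* FreeGroup (Fin n) :=
  FreeGroup.lift fun j =>
    if j = lo i then x (hi i)
    else if j = hi i then (x (hi i))⁻¹ * x (lo i) * x (hi i)
    else x j

/-- The inverse of `artinHom`. -/
def artinInv {n : ℕ} (i : Fin (n - 1)) : FreeGroup (Fin n) →* FreeGroup (Fin n) :=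
  FreeGroup.lift fun j =>
    if j = lo i then x (lo i) * x (hi i) * (x (lo i))⁻¹
    else if j = hi i then x (lo i)
    else x j

theorem hi_ne_lo {n : ℕ} (i : Fin (n - 1)) : hi i ≠ lo i := by
  simp [lo, hi, Fin.ext_iff]

theorem artinHom_lo {n : ℕ} (i : Fin (n - 1)) : artinHom i (x (lo i)) = x (hi i) := by
  simp [artinHom]

theorem artinHom_hi {n : ℕ} (i : Fin (n - 1)) :
    artinHom i (x (hi i)) = (x (hi i))⁻¹ * x (lo i) * x (hi i) := by
  simp [artinHom, hi_ne_lo]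

theorem artinHom_ne {n : ℕ} (i : Fin (n - 1)) (j : Fin n) (h1 : j ≠ lo i) (h2 : j ≠ hi i) :
    artinHom i (x j) = x j := by
  simp [artinHom, h1, h2]

/-- The automorphism `α(s_i)` of `F_n`. -/
def artinGen {n : ℕ} (i : Fin (n - 1)) : MulAut (FreeGroup (Fin n)) :=
  MonoidHom.toMulEquiv (artinHom i) (artinInv i)
    (by
      ext j
      by_cases h1 : j = lo i
      · subst h1; simp [artinHom, artinInv, hi_ne_lo]
      by_cases h2 : j = hi i
      · subst h2; simp [artinHom, artinInv, hi_ne_lo, mul_assoc]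
      simp [artinHom, artinInv, h1, h2])
    (by
      ext j
      by_cases h1 : j = lo i
      · subst h1; simp [artinHom, artinInv, hi_ne_lo, mul_assoc]
      by_cases h2 : j = hi i
      · subst h2; simp [artinHom, artinInv, hi_ne_lo]
      simp [artinHom, artinInv, h1, h2])

theorem artinGen_apply {n : ℕ} (i : Fin (n - 1)) (y : FreeGroup (Fin n)) :
    artinGen i y = artinHom i y := rfl

theorem mulAut_ext {n : ℕ} {f g : MulAut (FreeGroup (Fin n))}
    (h : ∀ j, f (x j) = g (x j)) : f = g := by
  have : f.toMonoidHom = g.toMonoidHom := FreeGroup.ext_hom _ _ h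
  exact MulEquiv.ext fun y => DFunLike.congr_fun this y

/-- Artin's representation `α : B_n → Aut F_n`. -/
def artin (n : ℕ) : BraidGroup n →* MulAut (FreeGroup (Fin n)) :=
  PresentedGroup.toGroup (f := fun i : Fin (n - 1) => artinGen i) <| by
    refine lift_rels _ ?_ ?_
    · intro i j hij
      refine mulAut_ext fun k => ?_
      have e : lo j = hi i := by simp [lo, hi, Fin.ext_iff, hij]
      have a1 : hi j ≠ lo i := by simp [lo, hi, Fin.ext_iff]; omega
      have a2 : hi j ≠ hi i := by simp [hi, Fin.ext_iff]; omega
      have h1 := artinHom_lo j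
      have h2 := artinHom_hi j
      have h3 := artinHom_ne i (hi j) a1 a2
      have h4 := artinHom_ne j (lo i) (by rw [e]; exact (hi_ne_lo i).symm) a1.symm
      have h5 := artinHom_lo i
      have h6 := artinHom_hi i
      rw [e] at h1 h2
      simp only [MulAut.mul_apply, artinGen_apply]
      by_cases k1 : k = lo i
      · subst k1; simp [h1, h2, h3, h4, h5, h6]
      by_cases k2 : k = hi i
      · subst k2; simp [h1, h2, h3, h4, h5, h6]
      by_cases k3 : k = hi j
      · subst k3; simp only [h1, h2, h3, h4, h5, h6, map_mul, map_inv]; group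
      have h7 := artinHom_ne i k k1 k2
      have h8 := artinHom_ne j k (by rw [e]; exact k2) k3
      simp only [h7, h8]
    · intro i j hij
      refine mulAut_ext fun k => ?_
      have n1 : lo i ≠ lo j := by simp [lo, Fin.ext_iff]; omega
      have n2 : lo i ≠ hi j := by simp [lo, hi, Fin.ext_iff]; omega
      have n3 : hi i ≠ lo j := by simp [lo, hi, Fin.ext_iff]; omega
      have n4 : hi i ≠ hi j := by simp [hi, Fin.ext_iff]; omega
      have h1 := artinHom_lo i
      have h2 := artinHom_hi i
      have h3 := artinHom_lo j
      have h4 := artinHom_hi j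
      have h5 := artinHom_ne j _ n1 n2
      have h6 := artinHom_ne j _ n3 n4
      have h7 := artinHom_ne i _ n1.symm n3.symm
      have h8 := artinHom_ne i _ n2.symm n4.symm
      simp only [MulAut.mul_apply, artinGen_apply]
      by_cases k1 : k = lo i
      · subst k1; simp only [h1, h2, h3, h4, h5, h6, h7, h8, map_mul, map_inv]
      by_cases k2 : k = hi i
      · subst k2; simp only [h1, h2, h3, h4, h5, h6, h7, h8, map_mul, map_inv]
      by_cases k3 : k = lo j
      · subst k3; simp only [h1, h2, h3, h4, h5, h6, h7, h8, map_mul, map_inv]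
      by_cases k4 : k = hi j
      · subst k4; simp only [h1, h2, h3, h4, h5, h6, h7, h8, map_mul, map_inv]
      simp only [artinHom_ne i k k1 k2, artinHom_ne j k k3 k4]

/-- The restriction of Artin's representation to the pure braid group `P_n`. -/
def artinPure (n : ℕ) : PureBraidGroup n →* MulAut (FreeGroup (Fin n)) :=
  (artin n).comp (PureBraidGroup n).subtype

section Cohomology

variable {K H : Type*} [Group K] [Group H]

/-- The group `Z¹(K, Hom(H, 𝕋))` of 1-cocycles for the action `α` of `K` on `H`:
functions `φ(a, y)`, multiplicative in `y`, with `φ(ab, y) = φ(a, α_b(y)) φ(b, y)`. -/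
def Z1 (α : K →* MulAut H) : Subgroup (K → (H →* Circle)) where
  carrier := {φ | ∀ (a b : K) (y : H), φ (a * b) y = φ a (α b y) * φ b y}
  mul_mem' := by
    intro φ ψ hφ hψ a b y
    simp only [Pi.mul_apply, MonoidHom.mul_apply, hφ a b y, hψ a b y]
    exact mul_mul_mul_comm _ _ _ _
  one_mem' := by
    intro a b y
    simp
  inv_mem' := by
    intro φ hφ a b y
    simp only [Pi.inv_apply, MonoidHom.inv_apply, hφ a b y, mul_inv]

/-- The subgroup `B¹(K, Hom(H, 𝕋))` of `Z¹(K, Hom(H, 𝕋))`: the functions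
`h(a, y) = f(α_a(y)) f(y)⁻¹` with `f ∈ Hom(H, 𝕋)`. -/
def B1 (α : K →* MulAut H) : Subgroup (Z1 α) where
  carrier := {h | ∃ f : H →* Circle, ∀ (a : K) (y : H), h.1 a y = f (α a y) * (f y)⁻¹}
  mul_mem' := by
    rintro h k ⟨f, hf⟩ ⟨g, hg⟩
    refine ⟨f * g, fun a y => ?_⟩
    simp only [Subgroup.coe_mul, Pi.mul_apply, MonoidHom.mul_apply, hf a y, hg a y, mul_inv]
    exact mul_mul_mul_comm _ _ _ _
  one_mem' := ⟨1, fun a y => by simp⟩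
  inv_mem' := by
    rintro h ⟨f, hf⟩
    refine ⟨f⁻¹, fun a y => ?_⟩
    simp only [Subgroup.coe_inv, Pi.inv_apply, MonoidHom.inv_apply, hf a y, mul_inv]

/-- The cohomology group `H¹(K, Hom(H, 𝕋)) = Z¹(K, Hom(H, 𝕋)) / B¹(K, Hom(H, 𝕋))`. -/
abbrev H1 (α : K →* MulAut H) : Type _ := Z1 α ⧸ B1 α

/-- The class in `H¹(K, Hom(H, 𝕋))` of a 1-cocycle. -/
noncomputable def toH1 (α : K →* MulAut H) : Z1 α →* H1 α := QuotientGroup.mk' (B1 α)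

end Cohomology

end ArtinBraid

/-! A homomorphism from F_n to an abelian group does not see conjugations, so it sees a braid only
through its permutation (`hom_artin_apply`). A cocycle on B_n is therefore a cocycle for the
permutation action on the n strands. It is determined by the array φ(s_i, x_k), and the braid
relations are the only constraints on that array (`exists_cocycle`).

Read strand by strand, these relations say that all entries with k ≠ i, i+1 coincide and that the
products φ(s_i, x_i) φ(s_i, x_{i+1}) coincide (`Z1_off_const`, `Z1_mul_const`). The entries φ(s_i,
x_i) remain free. They can be prescribed as the ratios f(x_{i+1}) / f(x_i), which is exactly the
freedom of a coboundary. Hence μ₁ and μ₂ detect the class (`mem_B1_iff`), and all their values occur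
(`exists_Z1_of_invariants`).

For P_n the action is trivial, so everything reduces to Hom(P_n, A) for abelian A: such a
homomorphism is an arbitrary choice of one value for each pair of strands. It is determined by these
values because the Coxeter presentation of S_n makes P_n the normal closure of the squares s_k²
(`pureBraidGroup_le_normalClosure`), while conjugation by s_k permutes the pure generators up to
conjugation inside P_n, which A does not see (`conj_pureGen`). The values are arbitrary because
linking numbers separate the pairs (`linking_pureGen`). -/

namespace ArtinBraid

/-! ### The Coxeter presentation of the symmetric group -/

section Coxeter

variable {Q : Type*} [Group Q]

/-- The product `t k * t (k + 1) * ⋯ * t (k + d - 1)`. -/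
def ascProd (t : ℕ → Q) : ℕ → ℕ → Q
  | _, 0 => 1
  | k, d + 1 => t k * ascProd t (k + 1) d

theorem ascProd_succ (t : ℕ → Q) (k d : ℕ) :
    ascProd t k (d + 1) = t k * ascProd t (k + 1) d := rfl

theorem commute_ascProd {t : ℕ → Q} (hfar : ∀ i j, i + 2 ≤ j → t i * t j = t j * t i)
    {i k : ℕ} (d : ℕ) (h : i + 2 ≤ k) : t i * ascProd t k d = ascProd t k d * t i := by
  induction d generalizing k with
  | zero => simp [ascProd]
  | succ d ih =>
    rw [ascProd_succ, ← mul_assoc, hfar i k h, mul_assoc, ih (by omega), mul_assoc]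

/-- The factor t (i + 1) commutes past the factors of index below i. The braid relation then turns t
(i + 1) t i t (i + 1) into t i t (i + 1) t i, and the last t i commutes with all later factors. -/
theorem mul_ascProd_shift {t : ℕ → Q} {M : ℕ}
    (hfar : ∀ i j, i + 2 ≤ j → t i * t j = t j * t i)
    (hbraid : ∀ i, i + 1 < M → t i * t (i + 1) * t i = t (i + 1) * t i * t (i + 1))
    {i k d : ℕ} (hk : k ≤ i) (hi : i + 1 < k + d) (hM : k + d ≤ M) :
    t (i + 1) * ascProd t k d = ascProd t k d * t i := by
  induction d generalizing k with
  | zero => omega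
  | succ d ih =>
    rcases hk.eq_or_lt with rfl | hk
    · obtain ⟨e, rfl⟩ : ∃ e, d = e + 1 := ⟨d - 1, by omega⟩
      rw [ascProd_succ, ascProd_succ]
      have h1 := hbraid k (by omega)
      have h2 := commute_ascProd hfar e (show k + 2 ≤ k + 1 + 1 by omega)
      calc t (k + 1) * (t k * (t (k + 1) * ascProd t (k + 1 + 1) e))
          = (t (k + 1) * t k * t (k + 1)) * ascProd t (k + 1 + 1) e := by group
        _ = t k * t (k + 1) * (t k * ascProd t (k + 1 + 1) e) := by rw [← h1]; group
        _ = _ := by rw [h2]; group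
    · rw [ascProd_succ, ← mul_assoc, ← hfar k (i + 1) (by omega), mul_assoc,
        ih (by omega) (by omega) (by omega), mul_assoc]

/-- The subgroup generated by the first `m` of the elements `t i`. -/
def initialSubgroup (t : ℕ → Q) (m : ℕ) : Subgroup Q := Subgroup.closure (t '' Set.Iio m)

theorem mem_initialSubgroup (t : ℕ → Q) {i m : ℕ} (h : i < m) : t i ∈ initialSubgroup t m :=
  Subgroup.subset_closure ⟨i, h, rfl⟩

/-- The m + 2 cosets of `initialSubgroup t m` represented by the ascending products ending at t m
are permuted by left multiplication by each t i. According to the position of i relative to k, the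
factor t i is absorbed on the right, lengthens the product, cancels its first factor, or passes
through as t (i - 1). -/
theorem exists_ascProd_mul {t : ℕ → Q} {M : ℕ}
    (hfar : ∀ i j, i + 2 ≤ j → t i * t j = t j * t i)
    (hbraid : ∀ i, i + 1 < M → t i * t (i + 1) * t i = t (i + 1) * t i * t (i + 1))
    (hsq : ∀ i, t i * t i = 1) {m : ℕ} (hm : m + 1 ≤ M) {q : Q}
    (hq : q ∈ initialSubgroup t (m + 1)) :
    ∃ k d h, k + d = m + 1 ∧ h ∈ initialSubgroup t m ∧ q = ascProd t k d * h := by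
  have step : ∀ i < m + 1, ∀ k d h, k + d = m + 1 → h ∈ initialSubgroup t m →
      ∃ k' d' h', k' + d' = m + 1 ∧ h' ∈ initialSubgroup t m ∧
        t i * (ascProd t k d * h) = ascProd t k' d' * h' := by
    intro i hi k d h hkd hh
    rcases lt_trichotomy (i + 1) k with h1 | h1 | h1
    · refine ⟨k, d, t i * h, hkd, mul_mem (mem_initialSubgroup t (by omega)) hh, ?_⟩
      rw [← mul_assoc, commute_ascProd hfar d (by omega), mul_assoc]
    · subst h1
      exact ⟨i, d + 1, h, by omega, hh, by rw [ascProd_succ, mul_assoc]⟩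
    · rcases (Nat.lt_succ_iff.mp h1).eq_or_lt with h2 | h2
      · subst h2
        obtain ⟨e, rfl⟩ : ∃ e, d = e + 1 := ⟨d - 1, by omega⟩
        refine ⟨k + 1, e, h, by omega, hh, ?_⟩
        rw [ascProd_succ, mul_assoc, ← mul_assoc (t k), hsq, one_mul]
      · obtain ⟨j, rfl⟩ : ∃ j, i = j + 1 := ⟨i - 1, by omega⟩
        refine ⟨k, d, t j * h, hkd, mul_mem (mem_initialSubgroup t (by omega)) hh, ?_⟩
        rw [← mul_assoc, mul_ascProd_shift hfar hbraid (by omega) (by omega) (by omega),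
          mul_assoc]
  refine Subgroup.closure_induction_left (p := fun q _ => ∃ k d h, k + d = m + 1 ∧
    h ∈ initialSubgroup t m ∧ q = ascProd t k d * h) ?_ ?_ ?_ hq
  · exact ⟨m + 1, 0, 1, rfl, one_mem _, by simp [ascProd]⟩
  · rintro _ ⟨i, hi, rfl⟩ y _ ⟨k, d, h, hkd, hh, rfl⟩
    exact step i hi k d h hkd hh
  · rintro _ ⟨i, hi, rfl⟩ y _ ⟨k, d, h, hkd, hh, rfl⟩
    rw [inv_eq_of_mul_eq_one_left (hsq i)]
    exact step i hi k d h hkd hh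

/-- The Coxeter presentation of the symmetric group, as an injectivity statement. -/
theorem eq_one_of_map_perm_eq_one {X : Type*} [DecidableEq X] {t : ℕ → Q} {M : ℕ}
    (hfar : ∀ i j, i + 2 ≤ j → t i * t j = t j * t i)
    (hbraid : ∀ i, i + 1 < M → t i * t (i + 1) * t i = t (i + 1) * t i * t (i + 1))
    (hsq : ∀ i, t i * t i = 1) (π : Q →* Equiv.Perm X) (e : ℕ → X)
    (he : Set.InjOn e (Set.Iic M)) (hπ : ∀ i < M, π (t i) = Equiv.swap (e i) (e (i + 1)))
    {m : ℕ} (hm : m ≤ M) {q : Q} (hq : q ∈ initialSubgroup t m) (h1 : π q = 1) : q = 1 := by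
  induction m generalizing q with
  | zero => simpa [initialSubgroup] using hq
  | succ m ih =>
    obtain ⟨k, d, h, hkd, hh, rfl⟩ := exists_ascProd_mul hfar hbraid hsq hm hq
    -- The point e (m + 1) is fixed by h, and the ascending product sends it to e k. A trivial image
    -- thus forces k = m + 1, an empty product, and the induction continues with h.
    have fixes : π h (e (m + 1)) = e (m + 1) := by
      suffices initialSubgroup t m ≤
          (MulAction.stabilizer (Equiv.Perm X) (e (m + 1))).comap π from this hh
      refine (Subgroup.closure_le _).2 ?_
      rintro _ ⟨i, hi, rfl⟩
      have hi : i < m := hi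
      change π (t i) (e (m + 1)) = e (m + 1)
      rw [hπ i (by omega)]
      refine Equiv.swap_apply_of_ne_of_ne ?_ ?_ <;>
      · intro hc
        have := he (by simp; omega) (by simp; omega) hc
        omega
    have moves : ∀ d k, k + d ≤ M → π (ascProd t k d) (e (k + d)) = e k := by
      intro d
      induction d with
      | zero => intro k _; simp [ascProd]
      | succ d ihd =>
        intro k hk
        have := ihd (k + 1) (by omega)
        rw [ascProd_succ, map_mul, Equiv.Perm.mul_apply, show k + (d + 1) = k + 1 + d by omega,
          this, hπ k (by omega), Equiv.swap_apply_right]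
    have key : e k = e (m + 1) := by
      have h2 := congrArg (fun σ : Equiv.Perm X => σ (e (m + 1))) h1
      simp only [map_mul, Equiv.Perm.mul_apply, fixes, Equiv.Perm.one_apply] at h2
      rw [← h2, ← hkd, moves d k (by omega)]
    have hk := he (by simp; omega) (by simp; omega) key
    obtain rfl : d = 0 := by omega
    simp only [ascProd, one_mul] at h1 ⊢
    exact ih (by omega) hh h1

end Coxeter

/-! ### Cocycles on the braid group through the permutation action -/

section Cocycle

theorem s_braid {n : ℕ} {i j : Fin (n - 1)} (hij : (j : ℕ) = i + 1) :
    (s i * s j * s i : BraidGroup n) = s j * s i * s j :=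
  mul_inv_eq_one.1 <|
    PresentedGroup.one_of_mem (rels := braidRels n) (Or.inl ⟨i, j, hij, rfl⟩)

theorem s_comm {n : ℕ} {i j : Fin (n - 1)} (hij : (i : ℕ) + 2 ≤ j) :
    (s i * s j : BraidGroup n) = s j * s i :=
  mul_inv_eq_one.1 <|
    PresentedGroup.one_of_mem (rels := braidRels n) (Or.inr ⟨i, j, Or.inl hij, rfl⟩)

theorem closure_range_s (n : ℕ) :
    Subgroup.closure (Set.range (s : Fin (n - 1) → BraidGroup n)) = ⊤ :=
  PresentedGroup.closure_range_of (braidRels n)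

theorem braidGroup_induction {n : ℕ} {p : BraidGroup n → Prop} (gen : ∀ i, p (s i)) (one : p 1)
    (mul : ∀ a b, p a → p b → p (a * b)) (inv : ∀ a, p a → p a⁻¹) (a : BraidGroup n) : p a := by
  have ha : a ∈ Subgroup.closure (Set.range (s : Fin (n - 1) → BraidGroup n)) := by
    rw [closure_range_s]; trivial
  refine Subgroup.closure_induction (p := fun a _ => p a) ?_ one (fun a b _ _ => mul a b)
    (fun a _ => inv a) ha
  rintro _ ⟨i, rfl⟩
  exact gen i

theorem toPerm_s {n : ℕ} (i : Fin (n - 1)) : toPerm n (s i) = Equiv.swap (lo i) (hi i) :=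
  PresentedGroup.toGroup.of _

theorem artin_s {n : ℕ} (i : Fin (n - 1)) : artin n (s i) = artinGen i :=
  PresentedGroup.toGroup.of _

/-- On homomorphisms to abelian groups, Artin's representation acts through `S_n`. -/
theorem hom_artin_apply {n : ℕ} {A : Type*} [CommGroup A] (a : BraidGroup n)
    (f : FreeGroup (Fin n) →* A) (j : Fin n) :
    f (artin n a (x j)) = f (x (toPerm n a j)) := by
  induction a using braidGroup_induction generalizing f j with
  | gen i =>
    rw [artin_s, artinGen_apply, toPerm_s]
    by_cases h1 : j = lo i
    · rw [h1, artinHom_lo, Equiv.swap_apply_left]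
    by_cases h2 : j = hi i
    · rw [h2, artinHom_hi, Equiv.swap_apply_right]
      simp
    rw [artinHom_ne i j h1 h2, Equiv.swap_apply_of_ne_of_ne h1 h2]
  | one => simp
  | mul a b ha hb =>
    rw [map_mul, MulAut.mul_apply, map_mul, Equiv.Perm.mul_apply, ← ha]
    exact hb (f.comp (artin n a).toMonoidHom) j
  | inv a ha =>
    have := ha (f.comp (artin n a⁻¹).toMonoidHom) ((toPerm n a)⁻¹ j)
    simpa using this.symm

/-- A family of functions satisfying the relations of a 1-cocycle on the generators of `B_n`
extends to a 1-cocycle. -/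
theorem exists_cocycle {n : ℕ} {X M : Type*} [CommGroup M] (ρ : BraidGroup n →* Equiv.Perm X)
    (c : Fin (n - 1) → X → M)
    (h1 : ∀ i j : Fin (n - 1), (j : ℕ) = i + 1 → ∀ k,
      c i (ρ (s j) (ρ (s i) k)) * c j (ρ (s i) k) * c i k =
        c j (ρ (s i) (ρ (s j) k)) * c i (ρ (s j) k) * c j k)
    (h2 : ∀ i j : Fin (n - 1), (i : ℕ) + 2 ≤ j → ∀ k,
      c i (ρ (s j) k) * c j k = c j (ρ (s i) k) * c i k) :
    ∃ φ : BraidGroup n → X → M, (∀ a b k, φ (a * b) k = φ a (ρ b k) * φ b k) ∧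
      ∀ i, φ (s i) = c i := by
  -- Skew products on X × M compose by the cocycle rule, so `h1` and `h2` say precisely that these
  -- permutations satisfy the braid relations.
  let g : Fin (n - 1) → Equiv.Perm (X × M) := fun i =>
    { toFun := fun p => (ρ (s i) p.1, c i p.1 * p.2)
      invFun := fun p => ((ρ (s i)).symm p.1, (c i ((ρ (s i)).symm p.1))⁻¹ * p.2)
      left_inv := fun p => by simp
      right_inv := fun p => by simp }
  have hg : ∀ i p, g i p = (ρ (s i) p.1, c i p.1 * p.2) := fun i p => rfl
  have hrels : ∀ r ∈ braidRels n, FreeGroup.lift g r = 1 := by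
    refine lift_rels g ?_ ?_
    · intro i j hij
      ext p
      · have := congrArg (fun a => ρ a p.1) (s_braid hij)
        simpa [hg] using this
      · have := h1 i j hij p.1
        simp only [Equiv.Perm.mul_apply, hg, ← mul_assoc, this]
    · intro i j hij
      ext p
      · have := congrArg (fun a => ρ a p.1) (s_comm hij)
        simpa [hg] using this
      · have := h2 i j hij p.1
        simp only [Equiv.Perm.mul_apply, hg, ← mul_assoc, this]
  let Θ : BraidGroup n →* Equiv.Perm (X × M) := PresentedGroup.toGroup hrels
  have hΘs : ∀ i, Θ (s i) = g i := fun i => PresentedGroup.toGroup.of hrels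
  -- Skew products are closed under composition and inversion, so every braid acts by one; its
  -- multiplier, read off at the point (k, 1), is the cocycle.
  have hE : ∀ a, ∃ u : X → M, ∀ p, Θ a p = (ρ a p.1, u p.1 * p.2) := by
    intro a
    induction a using braidGroup_induction with
    | gen i => exact ⟨c i, fun p => by rw [hΘs, hg]⟩
    | one => exact ⟨1, by simp⟩
    | mul a b ha hb =>
      obtain ⟨u, hu⟩ := ha
      obtain ⟨v, hv⟩ := hb
      exact ⟨fun k => u (ρ b k) * v k, fun p => by simp [hu, hv, mul_assoc]⟩
    | inv a ha =>
      obtain ⟨u, hu⟩ := ha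
      refine ⟨fun k => (u ((ρ a)⁻¹ k))⁻¹, fun p => ?_⟩
      rw [map_inv, Equiv.Perm.inv_eq_iff_eq, hu]
      simp
  have hΘ : ∀ a p, Θ a p = (ρ a p.1, (Θ a (p.1, 1)).2 * p.2) := by
    intro a p
    obtain ⟨u, hu⟩ := hE a
    simp [hu]
  refine ⟨fun a k => (Θ a (k, 1)).2, ?_, ?_⟩
  · intro a b k
    simp only [map_mul, Equiv.Perm.mul_apply]
    rw [hΘ b (k, 1)]
    simp only [mul_one]
    rw [hΘ a]
  · intro i
    funext k
    simp [hΘs, hg]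

end Cocycle

/-! ### The two invariants and the cohomology of the full braid group -/

section Full

variable {n : ℕ}

theorem lo_ne_hi (i : Fin (n - 1)) : lo i ≠ hi i := (hi_ne_lo i).symm

theorem Z1_mul_apply {φ : BraidGroup n → (FreeGroup (Fin n) →* Circle)}
    (hφ : φ ∈ Z1 (artin n)) (a b : BraidGroup n) (k : Fin n) :
    φ (a * b) (x k) = φ a (x (toPerm n b k)) * φ b (x k) := by
  rw [hφ, hom_artin_apply]

theorem Z1_eq_one {φ : BraidGroup n → (FreeGroup (Fin n) →* Circle)}
    (hφ : φ ∈ Z1 (artin n)) (h : ∀ i j, φ (s i) (x j) = 1) : φ = 1 := by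
  have h1 : φ 1 = 1 := by
    refine MonoidHom.ext fun y => ?_
    simpa using hφ 1 1 y
  funext a
  induction a using braidGroup_induction with
  | gen i => exact FreeGroup.ext_hom _ _ fun j => by simpa using h i j
  | one => exact h1
  | mul a b ha hb =>
    refine MonoidHom.ext fun y => ?_
    rw [hφ, ha, hb]
    simp
  | inv a ha =>
    refine MonoidHom.ext fun y => ?_
    have := hφ a⁻¹ a ((artin n a)⁻¹ y)
    rw [inv_mul_cancel, h1, ha] at this
    simpa using this.symm

/-- A cocycle for the permutation action extends to a cocycle with values in `Hom(F_n, 𝕋)`. -/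
theorem exists_Z1 {ψ : BraidGroup n → Fin n → Circle}
    (hψ : ∀ a b k, ψ (a * b) k = ψ a (toPerm n b k) * ψ b k) :
    ∃ φ : Z1 (artin n), ∀ a k, φ.1 a (x k) = ψ a k := by
  refine ⟨⟨fun a => FreeGroup.lift (ψ a), fun a b y => ?_⟩, fun a k => by simp⟩
  have : FreeGroup.lift (ψ (a * b)) =
      (FreeGroup.lift (ψ a)).comp (artin n b).toMonoidHom * FreeGroup.lift (ψ b) := by
    refine FreeGroup.ext_hom _ _ fun k => ?_
    rw [MonoidHom.mul_apply, MonoidHom.comp_apply, MulEquiv.coe_toMonoidHom,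
      show FreeGroup.of k = x k from rfl, hom_artin_apply]
    simp [hψ]
  exact DFunLike.congr_fun this y

/-- Evaluate s_i s_j = s_j s_i at x_i: the strand is moved by s_i only, and φ(s_i, x_i) cancels. -/
theorem Z1_comm {φ : BraidGroup n → (FreeGroup (Fin n) →* Circle)}
    (hφ : φ ∈ Z1 (artin n)) {i j : Fin (n - 1)} (hij : (i : ℕ) + 2 ≤ j ∨ (j : ℕ) + 2 ≤ i) :
    φ (s j) (x (lo i)) = φ (s j) (x (hi i)) := by
  have h : (s i * s j : BraidGroup n) = s j * s i :=
    hij.elim (fun h => s_comm h) (fun h => (s_comm h).symm)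
  have n1 : lo i ≠ lo j := by simp [lo, Fin.ext_iff]; omega
  have n2 : lo i ≠ hi j := by simp [lo, hi, Fin.ext_iff]; omega
  have h2 : φ (s i * s j) (x (lo i)) = φ (s j * s i) (x (lo i)) := by rw [h]
  rw [Z1_mul_apply hφ, Z1_mul_apply hφ, toPerm_s, toPerm_s,
    Equiv.swap_apply_of_ne_of_ne n1 n2, Equiv.swap_apply_left, mul_comm] at h2
  exact mul_right_cancel h2

theorem Z1_braid {φ : BraidGroup n → (FreeGroup (Fin n) →* Circle)}
    (hφ : φ ∈ Z1 (artin n)) {i j : Fin (n - 1)} (hij : (j : ℕ) = i + 1) (k : Fin n) :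
    φ (s i) (x (Equiv.swap (hi i) (hi j) (Equiv.swap (lo i) (hi i) k))) *
        φ (s j) (x (Equiv.swap (lo i) (hi i) k)) * φ (s i) (x k) =
      φ (s j) (x (Equiv.swap (lo i) (hi i) (Equiv.swap (hi i) (hi j) k))) *
        φ (s i) (x (Equiv.swap (hi i) (hi j) k)) * φ (s j) (x k) := by
  have e : lo j = hi i := by simp [lo, hi, hij]
  have h : φ (s i * s j * s i) (x k) = φ (s j * s i * s j) (x k) := by rw [s_braid hij]
  simpa only [Z1_mul_apply hφ, toPerm_s, e] using h

/-- On a strand fixed by both generators the braid relation reads a b a = b a b in an abelian group.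
-/
theorem Z1_braid_far {φ : BraidGroup n → (FreeGroup (Fin n) →* Circle)}
    (hφ : φ ∈ Z1 (artin n)) {i j : Fin (n - 1)} (hij : (j : ℕ) = i + 1) {k : Fin n}
    (h1 : k ≠ lo i) (h2 : k ≠ hi i) (h3 : k ≠ hi j) : φ (s i) (x k) = φ (s j) (x k) := by
  have := Z1_braid hφ hij k
  rw [Equiv.swap_apply_of_ne_of_ne h1 h2, Equiv.swap_apply_of_ne_of_ne h2 h3,
    Equiv.swap_apply_of_ne_of_ne h1 h2, mul_assoc, mul_assoc,
    mul_comm (φ (s i) (x k)) (φ (s j) (x k)), ← mul_assoc, ← mul_assoc,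
    mul_comm (φ (s i) (x k)) (φ (s j) (x k)), mul_assoc, mul_assoc] at this
  have := mul_left_cancel this
  rw [mul_comm (φ (s j) (x k))] at this
  exact mul_left_cancel this

theorem Z1_braid_hi {φ : BraidGroup n → (FreeGroup (Fin n) →* Circle)}
    (hφ : φ ∈ Z1 (artin n)) {i j : Fin (n - 1)} (hij : (j : ℕ) = i + 1) :
    φ (s i) (x (hi j)) = φ (s j) (x (lo i)) := by
  have n1 : hi j ≠ lo i := by simp [lo, hi, Fin.ext_iff]; omega
  have n2 : hi j ≠ hi i := by simp [hi, Fin.ext_iff]; omega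
  have := Z1_braid hφ hij (hi j)
  rw [Equiv.swap_apply_of_ne_of_ne n1 n2, Equiv.swap_apply_right,
    Equiv.swap_apply_right, mul_comm, ← mul_assoc] at this
  exact mul_right_cancel (mul_right_cancel this)

/-- This is the braid relation at the middle strand; the two off-diagonal factors cancel by
`Z1_braid_hi`. -/
theorem Z1_braid_mul {φ : BraidGroup n → (FreeGroup (Fin n) →* Circle)}
    (hφ : φ ∈ Z1 (artin n)) {i j : Fin (n - 1)} (hij : (j : ℕ) = i + 1) :
    φ (s i) (x (lo i)) * φ (s i) (x (hi i)) = φ (s j) (x (lo j)) * φ (s j) (x (hi j)) := by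
  have e : lo j = hi i := by simp [lo, hi, hij]
  have n1 : hi j ≠ lo i := by simp [lo, hi, Fin.ext_iff]; omega
  have n2 : hi j ≠ hi i := by simp [hi, Fin.ext_iff]; omega
  have := Z1_braid hφ hij (hi i)
  rw [Equiv.swap_apply_right, Equiv.swap_apply_of_ne_of_ne (lo_ne_hi i) n1.symm,
    Equiv.swap_apply_left, Equiv.swap_apply_of_ne_of_ne n1 n2, Z1_braid_hi hφ hij,
    mul_right_comm, mul_right_comm (φ (s j) (x (hi j)))] at this
  rw [e, mul_right_cancel this, mul_comm]

theorem Z1_mul_const {φ : BraidGroup n → (FreeGroup (Fin n) →* Circle)}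
    (hφ : φ ∈ Z1 (artin n)) (i j : Fin (n - 1)) :
    φ (s i) (x (lo i)) * φ (s i) (x (hi i)) = φ (s j) (x (lo j)) * φ (s j) (x (hi j)) := by
  have key : ∀ (m : ℕ) (h : m < n - 1), φ (s ⟨m, h⟩) (x (lo ⟨m, h⟩)) * φ (s ⟨m, h⟩) (x (hi ⟨m, h⟩)) =
      φ (s ⟨0, by omega⟩) (x (lo ⟨0, by omega⟩)) * φ (s ⟨0, by omega⟩) (x (hi ⟨0, by omega⟩)) := by
    intro m
    induction m with
    | zero => intro h; rfl
    | succ m ih =>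
      intro h
      rw [← ih (by omega)]
      exact (Z1_braid_mul hφ rfl).symm
  exact (key i i.2).trans (key j j.2).symm

/-- By `ha` each row is constant to the left and to the right of the block {i, i + 1}. By `hb` the
right parts of consecutive rows agree, and `hc` ties the left part of row i + 1 to the right part of
row i. -/
theorem eq_of_off_diagonal {M : Type*} {C : ℕ → ℕ → M}
    (ha : ∀ i j, i + 1 < n → j + 1 < n → (i + 2 ≤ j ∨ j + 2 ≤ i) → C j i = C j (i + 1))
    (hb : ∀ i k, i + 2 < n → k < n → k ≠ i → k ≠ i + 1 → k ≠ i + 2 → C i k = C (i + 1) k)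
    (hc : ∀ i, i + 2 < n → C i (i + 2) = C (i + 1) i)
    {i k : ℕ} (hi : i + 1 < n) (hk : k < n) (h1 : k ≠ i) (h2 : k ≠ i + 1) : C i k = C 0 2 := by
  have right : ∀ d i, i + 2 + d < n → C i (i + 2 + d) = C i (i + 2) := by
    intro d
    induction d with
    | zero => intros; rfl
    | succ d ih =>
      intro i h
      rw [← ih i (by omega)]
      exact (ha (i + 2 + d) i (by omega) (by omega) (by omega)).symm
  have left : ∀ k i, k < i → i + 1 < n → C i k = C i 0 := by
    intro k
    induction k with
    | zero => intros; rfl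
    | succ k ih =>
      intro i h h'
      rw [← ih i (by omega) h']
      exact (ha k i (by omega) (by omega) (by omega)).symm
  have diag : ∀ i, i + 2 < n → C i (i + 2) = C 0 2 := by
    intro i
    induction i with
    | zero => intros; rfl
    | succ i ih =>
      intro h
      rw [← ih (by omega), ← right 1 i (by omega)]
      exact (hb i _ (by omega) (by omega) (by omega) (by omega) (by omega)).symm
  rcases lt_or_gt_of_ne h1 with h | h
  · obtain ⟨j, rfl⟩ : ∃ j, i = j + 1 := ⟨i - 1, by omega⟩
    rw [left k _ h hi, ← left j _ (by omega) hi, ← hc j (by omega), diag j (by omega)]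
  · obtain ⟨d, rfl⟩ : ∃ d, k = i + 2 + d := ⟨k - (i + 2), by omega⟩
    rw [right d i hk, diag i (by omega)]

theorem Z1_off_const {φ : BraidGroup n → (FreeGroup (Fin n) →* Circle)}
    (hφ : φ ∈ Z1 (artin n)) {i i' : Fin (n - 1)} {j j' : Fin n}
    (h1 : j ≠ lo i) (h2 : j ≠ hi i) (h1' : j' ≠ lo i') (h2' : j' ≠ hi i') :
    φ (s i) (x j) = φ (s i') (x j') := by
  -- The array is extended by 1 to all natural indices; only entries inside the range are ever
  -- compared.
  let C : ℕ → ℕ → Circle := fun i k =>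
    if h : i < n - 1 ∧ k < n then φ (s ⟨i, h.1⟩) (x ⟨k, h.2⟩) else 1
  have hC : ∀ i k (hi : i < n - 1) (hk : k < n), C i k = φ (s ⟨i, hi⟩) (x ⟨k, hk⟩) :=
    fun i k hi hk => dif_pos ⟨hi, hk⟩
  have key : ∀ (i : Fin (n - 1)) (k : Fin n), k ≠ lo i → k ≠ hi i →
      φ (s i) (x k) = C 0 2 := by
    intro i k hl hh
    rw [← hC i k i.2 k.2]
    refine eq_of_off_diagonal (n := n) ?_ ?_ ?_ (by omega) k.2
      (fun h => hl (Fin.ext h)) (fun h => hh (Fin.ext h))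
    · intro i j hi hj hij
      rw [hC j i (by omega) (by omega), hC j (i + 1) (by omega) (by omega)]
      exact Z1_comm hφ (i := ⟨i, by omega⟩) (j := ⟨j, by omega⟩) hij
    · intro i k hi hk k1 k2 k3
      rw [hC i k (by omega) hk, hC (i + 1) k (by omega) hk]
      refine Z1_braid_far hφ rfl ?_ ?_ ?_ <;> simp [lo, ArtinBraid.hi, Fin.ext_iff] <;> omega
    · intro i hi
      rw [hC i _ (by omega) hi, hC (i + 1) i (by omega) (by omega)]
      exact Z1_braid_hi hφ (i := ⟨i, by omega⟩) (j := ⟨i + 1, by omega⟩) rfl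
  rw [key i j h1 h2, key i' j' h1' h2']

/-- The coboundary of f takes the values f(x_{i+1}) / f(x_i) and its inverse at the two strands of
s_i, and 1 elsewhere. Conversely, f is recovered by multiplying up the ratios φ(s_m, x_m), and a
cocycle is determined by its values on generators. -/
theorem mem_B1_iff (φ : Z1 (artin n)) : φ ∈ B1 (artin n) ↔
    (∀ i, φ.1 (s i) (x (lo i)) * φ.1 (s i) (x (hi i)) = 1) ∧
      ∀ i j, j ≠ lo i → j ≠ hi i → φ.1 (s i) (x j) = 1 := by
  constructor
  · rintro ⟨f, hf⟩
    refine ⟨fun i => ?_, fun i j h1 h2 => ?_⟩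
    · rw [hf, hf, hom_artin_apply, hom_artin_apply, toPerm_s, Equiv.swap_apply_left,
        Equiv.swap_apply_right]
      simp [mul_comm, mul_left_comm]
    · rw [hf, hom_artin_apply, toPerm_s, Equiv.swap_apply_of_ne_of_ne h1 h2, mul_inv_cancel]
  · rintro ⟨h1, h2⟩
    let C : ℕ → Circle := fun m =>
      if h : m < n - 1 then φ.1 (s ⟨m, h⟩) (x (lo ⟨m, h⟩)) else 1
    let f : FreeGroup (Fin n) →* Circle :=
      FreeGroup.lift fun k => ∏ m ∈ Finset.range k, C m
    have hf : ∀ k : Fin n, f (x k) = ∏ m ∈ Finset.range k, C m := fun k => by simp [f]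
    have hstep : ∀ i : Fin (n - 1), f (x (hi i)) = f (x (lo i)) * φ.1 (s i) (x (lo i)) := by
      intro i
      rw [hf, hf]
      simp [lo, hi, Finset.prod_range_succ, C]
    let β : BraidGroup n → (FreeGroup (Fin n) →* Circle) := fun a =>
      f.comp (artin n a).toMonoidHom * f⁻¹
    have hβ : ∀ a y, β a y = f (artin n a y) * (f y)⁻¹ := fun a y => rfl
    have hβZ : β ∈ Z1 (artin n) := by
      intro a b y
      rw [hβ, hβ, hβ, map_mul, MulAut.mul_apply]
      group
    have hone := Z1_eq_one (mul_mem φ.2 (inv_mem hβZ)) (fun i j => by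
      rw [Pi.mul_apply, MonoidHom.mul_apply, Pi.inv_apply, MonoidHom.inv_apply, mul_inv_eq_one,
        hβ, hom_artin_apply, toPerm_s]
      by_cases k1 : j = lo i
      · rw [k1, Equiv.swap_apply_left, hstep]
        simp [mul_comm]
      by_cases k2 : j = hi i
      · rw [k2, Equiv.swap_apply_right, hstep, eq_inv_of_mul_eq_one_right (h1 i)]
        simp
      · rw [h2 i j k1 k2, Equiv.swap_apply_of_ne_of_ne k1 k2, mul_inv_cancel])
    have hφβ : φ.1 = β := mul_inv_eq_one.1 hone
    exact ⟨f, fun a y => by rw [hφβ, hβ]⟩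

theorem exists_Z1_of_invariants (n : ℕ) (u v : Circle) : ∃ φ : Z1 (artin n),
    (∀ i, φ.1 (s i) (x (lo i)) * φ.1 (s i) (x (hi i)) = u) ∧
      ∀ i j, j ≠ lo i → j ≠ hi i → φ.1 (s i) (x j) = v := by
  -- Only the product at the two strands of s_i matters up to coboundary, so u is placed wholly on
  -- the lower one.
  let c : Fin (n - 1) → Fin n → Circle := fun i k =>
    if k = lo i then u else if k = hi i then 1 else v
  have c1 : ∀ i, c i (lo i) = u := fun i => if_pos rfl
  have c2 : ∀ i, c i (hi i) = 1 := fun i => by simp [c, hi_ne_lo]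
  have c3 : ∀ i k, k ≠ lo i → k ≠ hi i → c i k = v := fun i k h h' => by simp [c, h, h']
  obtain ⟨ψ, hψ, hψs⟩ := exists_cocycle (toPerm n) c (by
    intro i j hij k
    have e : lo j = hi i := by simp [lo, hi, hij]
    have n1 : hi j ≠ lo i := by simp [lo, hi, Fin.ext_iff]; omega
    have n2 : hi j ≠ hi i := by simp [hi, Fin.ext_iff]; omega
    have d1 := c1 j
    have d2 := c3 j (lo i) (by rw [e]; exact lo_ne_hi i) n1.symm
    have d3 := c3 i (hi j) n1 n2
    simp only [toPerm_s, e] at d1 ⊢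
    by_cases k1 : k = lo i
    · subst k1
      rw [Equiv.swap_apply_left, Equiv.swap_apply_left,
        Equiv.swap_apply_of_ne_of_ne (lo_ne_hi i) n1.symm, Equiv.swap_apply_left, d1, d2, d3, c1]
      ac_rfl
    by_cases k2 : k = hi i
    · subst k2
      rw [Equiv.swap_apply_right, Equiv.swap_apply_of_ne_of_ne (lo_ne_hi i) n1.symm,
        Equiv.swap_apply_left, Equiv.swap_apply_of_ne_of_ne n1 n2, d1, d2, d3, c1, c2, c2]
      simp [mul_comm]
    by_cases k3 : k = hi j
    · subst k3
      rw [Equiv.swap_apply_of_ne_of_ne n1 n2, Equiv.swap_apply_right,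
        Equiv.swap_apply_right, d2, d3, c2, c2]
      simp
    rw [Equiv.swap_apply_of_ne_of_ne k1 k2, Equiv.swap_apply_of_ne_of_ne k2 k3,
      Equiv.swap_apply_of_ne_of_ne k1 k2, c3 i k k1 k2, c3 j k (by rwa [e]) k3]) (by
    intro i j hij k
    have n1 : lo i ≠ lo j := by simp [lo, Fin.ext_iff]; omega
    have n2 : lo i ≠ hi j := by simp [lo, hi, Fin.ext_iff]; omega
    have n3 : hi i ≠ lo j := by simp [lo, hi, Fin.ext_iff]; omega
    have n4 : hi i ≠ hi j := by simp [hi, Fin.ext_iff]; omega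
    have d1 := c3 j _ n1 n2
    have d2 := c3 j _ n3 n4
    have d3 := c3 i _ n1.symm n3.symm
    have d4 := c3 i _ n2.symm n4.symm
    simp only [toPerm_s]
    by_cases k1 : k = lo i
    · subst k1
      rw [Equiv.swap_apply_of_ne_of_ne n1 n2, Equiv.swap_apply_left, d1, d2, mul_comm]
    by_cases k2 : k = hi i
    · subst k2
      rw [Equiv.swap_apply_of_ne_of_ne n3 n4, Equiv.swap_apply_right, d1, d2, mul_comm]
    by_cases k3 : k = lo j
    · subst k3
      rw [Equiv.swap_apply_of_ne_of_ne n1.symm n3.symm, Equiv.swap_apply_left, d3, d4, mul_comm]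
    by_cases k4 : k = hi j
    · subst k4
      rw [Equiv.swap_apply_of_ne_of_ne n2.symm n4.symm, Equiv.swap_apply_right, d3, d4, mul_comm]
    rw [Equiv.swap_apply_of_ne_of_ne k1 k2, Equiv.swap_apply_of_ne_of_ne k3 k4, mul_comm])
  obtain ⟨φ, hφ⟩ := exists_Z1 hψ
  refine ⟨φ, fun i => ?_, fun i j h1 h2 => ?_⟩
  · rw [hφ, hφ, hψs, c1, c2, mul_one]
  · rw [hφ, hψs, c3 i j h1 h2]

end Full

/-- A surjective homomorphism with kernel `N` induces an isomorphism on the quotient by `N`. -/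
theorem exists_quotient_mulEquiv {G H : Type*} [Group G] [Group H] (N : Subgroup G) [N.Normal]
    (f : G →* H) (hf : Function.Surjective f) (hker : ∀ g, g ∈ N ↔ f g = 1) :
    ∃ Φ : G ⧸ N ≃* H, ∀ g, Φ (QuotientGroup.mk' N g) = f g := by
  obtain rfl : N = f.ker := Subgroup.ext hker
  exact ⟨QuotientGroup.quotientKerEquivOfSurjective f hf, fun g => rfl⟩

/-- Evaluation of a cocycle. -/
noncomputable def Z1.eval {K H : Type*} [Group K] [Group H] (α : K →* MulAut H) (a : K) (y : H) :
    Z1 α →* Circle where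
  toFun φ := φ.1 a y
  map_one' := rfl
  map_mul' _ _ := rfl

theorem H1_artin_two : ∃ Φ : H1 (artin 2) ≃* Circle, ∀ (φ : Z1 (artin 2)) (i : Fin (2 - 1)),
    φ.1 (s i) (x (lo i)) * φ.1 (s i) (x (hi i)) = Φ (toH1 (artin 2) φ) := by
  let i₀ : Fin (2 - 1) := ⟨0, by omega⟩
  obtain ⟨Φ, hΦ⟩ := exists_quotient_mulEquiv (B1 (artin 2))
    (Z1.eval (artin 2) (s i₀) (x (lo i₀)) * Z1.eval (artin 2) (s i₀) (x (hi i₀))) (by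
      intro u
      obtain ⟨φ, hφ, -⟩ := exists_Z1_of_invariants 2 u 1
      exact ⟨φ, hφ i₀⟩) (by
      intro φ
      rw [mem_B1_iff]
      refine ⟨fun h => h.1 i₀, fun h => ⟨fun i => (Z1_mul_const φ.2 i i₀).trans h, ?_⟩⟩
      intro i j h1 h2
      -- With two strands there is no third one, so the off-diagonal condition is vacuous.
      simp only [lo, hi, ne_eq, Fin.ext_iff] at h1 h2
      omega)
  exact ⟨Φ, fun φ i => (Z1_mul_const φ.2 i i₀).trans (hΦ φ).symm⟩

theorem H1_artin {n : ℕ} (hn : 3 ≤ n) : ∃ Φ : H1 (artin n) ≃* Circle × Circle,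
    ∀ (φ : Z1 (artin n)) (i : Fin (n - 1)),
      φ.1 (s i) (x (lo i)) * φ.1 (s i) (x (hi i)) = (Φ (toH1 (artin n) φ)).1 ∧
      ∀ j : Fin n, j ≠ lo i → j ≠ hi i → φ.1 (s i) (x j) = (Φ (toH1 (artin n) φ)).2 := by
  let i₀ : Fin (n - 1) := ⟨0, by omega⟩
  let j₀ : Fin n := ⟨2, by omega⟩
  have hl : j₀ ≠ lo i₀ := by simp [j₀, i₀, lo]
  have hh : j₀ ≠ hi i₀ := by simp [j₀, i₀, hi]
  obtain ⟨Φ, hΦ⟩ := exists_quotient_mulEquiv (B1 (artin n))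
    ((Z1.eval (artin n) (s i₀) (x (lo i₀)) * Z1.eval (artin n) (s i₀) (x (hi i₀))).prod
      (Z1.eval (artin n) (s i₀) (x j₀))) (by
      rintro ⟨u, v⟩
      obtain ⟨φ, hφ, hφ'⟩ := exists_Z1_of_invariants n u v
      exact ⟨φ, Prod.ext (hφ i₀) (hφ' i₀ j₀ hl hh)⟩) (by
      intro φ
      rw [mem_B1_iff]
      refine ⟨fun h => Prod.ext (h.1 i₀) (h.2 i₀ j₀ hl hh), fun h => ⟨fun i => ?_, ?_⟩⟩
      · exact (Z1_mul_const φ.2 i i₀).trans (congrArg Prod.fst h)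
      · intro i j h1 h2
        exact (Z1_off_const φ.2 h1 h2 hl hh).trans (congrArg Prod.snd h))
  refine ⟨Φ, fun φ i => ⟨?_, fun j h1 h2 => ?_⟩⟩
  · exact (Z1_mul_const φ.2 i i₀).trans (congrArg Prod.fst (hΦ φ)).symm
  · exact (Z1_off_const φ.2 h1 h2 hl hh).trans (congrArg Prod.snd (hΦ φ)).symm

/-! ### The pure braid group as a normal closure -/

section Pure

variable {n : ℕ}

/-- The generator `s_k`, extended by `1` to all natural numbers `k`. -/
def sNat (n k : ℕ) : BraidGroup n := if h : k < n - 1 then s ⟨k, h⟩ else 1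

theorem sNat_of_lt {k : ℕ} (h : k < n - 1) : sNat n k = s ⟨k, h⟩ := dif_pos h

theorem sNat_of_le {k : ℕ} (h : n - 1 ≤ k) : sNat n k = 1 := dif_neg (by omega)

theorem sNat_comm {i j : ℕ} (hij : i + 2 ≤ j) : sNat n i * sNat n j = sNat n j * sNat n i := by
  by_cases hj : j < n - 1
  · rw [sNat_of_lt hj, sNat_of_lt (show i < n - 1 by omega)]
    exact s_comm hij
  · rw [sNat_of_le (k := j) (by omega), mul_one, one_mul]

theorem sNat_braid {i : ℕ} (hi : i + 1 < n - 1) :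
    sNat n i * sNat n (i + 1) * sNat n i = sNat n (i + 1) * sNat n i * sNat n (i + 1) := by
  rw [sNat_of_lt hi, sNat_of_lt (show i < n - 1 by omega)]
  exact s_braid rfl

theorem toPerm_sNat_sq (k : ℕ) : toPerm n (sNat n k * sNat n k) = 1 := by
  by_cases hk : k < n - 1
  · rw [sNat_of_lt hk, map_mul, toPerm_s, Equiv.swap_mul_self]
  · rw [sNat_of_le (by omega), mul_one, map_one]

instance : (PureBraidGroup n).Normal := inferInstanceAs (toPerm n).ker.Normal

theorem sNat_sq_mem (k : ℕ) : sNat n k * sNat n k ∈ PureBraidGroup n := toPerm_sNat_sq k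

/-- Modulo the squares, the generators satisfy the Coxeter relations, so the quotient maps
injectively to S_n. -/
theorem pureBraidGroup_le_normalClosure (n : ℕ) :
    PureBraidGroup n ≤ Subgroup.normalClosure (Set.range fun k => sNat n k * sNat n k) := by
  set N := Subgroup.normalClosure (Set.range fun k => sNat n k * sNat n k) with hN
  intro a ha
  rcases Nat.eq_zero_or_pos n with rfl | hn
  · have : IsEmpty (Fin (0 - 1)) := inferInstanceAs (IsEmpty (Fin 0))
    have : Set.range (s : Fin (0 - 1) → BraidGroup 0) = ∅ := Set.range_eq_empty _
    have h2 := closure_range_s 0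
    rw [this, Subgroup.closure_empty] at h2
    have : a ∈ (⊥ : Subgroup (BraidGroup 0)) := by rw [h2]; trivial
    rw [Subgroup.mem_bot.1 this]
    exact one_mem _
  have hle : N ≤ (toPerm n).ker := by
    refine Subgroup.normalClosure_le_normal ?_
    rintro _ ⟨k, rfl⟩
    exact toPerm_sNat_sq k
  let q := QuotientGroup.mk' N
  let π : BraidGroup n ⧸ N →* Equiv.Perm (Fin n) := QuotientGroup.lift N (toPerm n) hle
  have hπ : ∀ a, π (q a) = toPerm n a := fun a => rfl
  -- Reduction mod n only makes e total; it is the identity on the indices up to n - 1 that are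
  -- used. It needs n > 0, hence the separate case above.
  let e : ℕ → Fin n := fun k => ⟨k % n, Nat.mod_lt _ hn⟩
  have he : ∀ (k : ℕ) (h : k < n), e k = ⟨k, h⟩ := fun k h => Fin.ext (Nat.mod_eq_of_lt h)
  have hmem : q a ∈ initialSubgroup (fun k => q (sNat n k)) (n - 1) := by
    have : (⊤ : Subgroup (BraidGroup n)) ≤
        (initialSubgroup (fun k => q (sNat n k)) (n - 1)).comap q := by
      rw [← closure_range_s, Subgroup.closure_le]
      rintro _ ⟨i, rfl⟩
      have := mem_initialSubgroup (fun k => q (sNat n k)) i.2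
      rwa [sNat_of_lt i.2] at this
    exact this (Subgroup.mem_top a)
  have : q a = 1 := by
    refine eq_one_of_map_perm_eq_one (t := fun k => q (sNat n k)) (M := n - 1) ?_ ?_ ?_ π e ?_ ?_
      le_rfl hmem ?_
    · intro i j hij
      rw [← map_mul, sNat_comm hij, map_mul]
    · intro i hi
      simp only [← map_mul, sNat_braid hi]
    · intro i
      rw [← map_mul]
      exact (QuotientGroup.eq_one_iff _).2 (Subgroup.subset_normalClosure ⟨i, rfl⟩)
    · intro i hi j hj h
      simp only [Set.mem_Iic] at hi hj
      rw [he i (by omega), he j (by omega)] at h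
      exact congrArg Fin.val h
    · intro i hi
      rw [hπ, sNat_of_lt hi, toPerm_s, he i (by omega), he (i + 1) (by omega)]
      rfl
    · exact ha
  exact (QuotientGroup.eq_one_iff _).1 this

/-! ### Pure generators and their conjugates -/

/-- The pure braid generator in which strand `i + d + 1` passes once around strand `i`. -/
def pureGen (n i : ℕ) : ℕ → BraidGroup n
  | 0 => sNat n i * sNat n i
  | d + 1 => sNat n (i + 1 + d) * pureGen n i d * (sNat n (i + 1 + d))⁻¹

theorem pureGen_succ (i d : ℕ) :
    pureGen n i (d + 1) = sNat n (i + 1 + d) * pureGen n i d * (sNat n (i + 1 + d))⁻¹ := rfl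

theorem pureGen_mem (i d : ℕ) : pureGen n i d ∈ PureBraidGroup n := by
  induction d with
  | zero => exact sNat_sq_mem i
  | succ d ih => exact Subgroup.Normal.conj_mem inferInstance _ ih _

theorem commute_pureGen_far {k i d : ℕ} (h : k + 2 ≤ i ∨ i + d + 2 ≤ k) :
    Commute (sNat n k) (pureGen n i d) := by
  have key : ∀ j, k + 2 ≤ j ∨ j + 2 ≤ k → Commute (sNat n k) (sNat n j) := fun j hj =>
    hj.elim (fun h => sNat_comm h) (fun h => (sNat_comm h).symm)
  induction d with
  | zero => exact (key i (by omega)).mul_right (key i (by omega))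
  | succ d ih =>
    have := key (i + 1 + d) (by omega)
    exact (this.mul_right (ih (by omega))).mul_right this.inv_right

/-- Here s_k exchanges two strands lying strictly between the linked ones. In the critical case k =
i + d, the relation a b a = b a b carries a through the conjugating word b a and turns it into b,
which commutes with the inner generator. -/
theorem commute_pureGen_mid {k i d : ℕ} (hn : i + d < n - 1) (h1 : i < k) (h2 : k < i + d) :
    Commute (sNat n k) (pureGen n i d) := by
  induction d with
  | zero => omega
  | succ d ih =>
    rcases Nat.lt_or_ge k (i + d) with h | h
    · have : Commute (sNat n k) (sNat n (i + 1 + d)) := sNat_comm (by omega)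
      exact (this.mul_right (ih (by omega) h)).mul_right this.inv_right
    · obtain ⟨e, rfl⟩ : ∃ e, d = e + 1 := ⟨d - 1, by omega⟩
      obtain rfl : k = i + 1 + e := by omega
      have hc : Commute (sNat n (i + 1 + e + 1)) (pureGen n i e) :=
        commute_pureGen_far (by omega)
      have hb := sNat_braid (n := n) (i := i + 1 + e) (by omega)
      rw [pureGen_succ, pureGen_succ, show i + 1 + (e + 1) = i + 1 + e + 1 by omega]
      generalize sNat n (i + 1 + e) = a at *
      generalize sNat n (i + 1 + e + 1) = b at *
      generalize pureGen n i e = g at *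
      rw [commute_iff_eq, ← mul_inv_eq_iff_eq_mul]
      calc a * (b * (a * g * a⁻¹) * b⁻¹) * a⁻¹
          = (a * b * a) * g * (a * b * a)⁻¹ := by group
        _ = b * a * (b * g * b⁻¹) * a⁻¹ * b⁻¹ := by rw [hb]; group
        _ = _ := by rw [hc.eq]; group

theorem conj_pureGen_left {i d : ℕ} (hn : i + (d + 1) < n - 1) :
    sNat n i * pureGen n i (d + 1) * (sNat n i)⁻¹ = pureGen n (i + 1) d := by
  induction d with
  | zero =>
    have hb := sNat_braid (n := n) (i := i) (by omega)
    simp only [pureGen, add_zero]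
    generalize sNat n i = a at *
    generalize sNat n (i + 1) = b at *
    calc a * (b * (a * a) * b⁻¹) * a⁻¹ = (a * b * a) * a * (a * b)⁻¹ := by group
      _ = b * a * b * a * (a * b)⁻¹ := by rw [hb]
      _ = b * (a * b * a) * (a * b)⁻¹ := by group
      _ = b * b := by rw [hb]; group
  | succ d ih =>
    have hc : Commute (sNat n i) (sNat n (i + 1 + (d + 1))) := sNat_comm (by omega)
    rw [pureGen_succ i (d + 1), pureGen_succ (i + 1) d, ← ih (by omega),
      show i + 1 + 1 + d = i + 1 + (d + 1) by omega]
    generalize sNat n (i + 1 + (d + 1)) = b at *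
    generalize sNat n i = a at *
    generalize pureGen n i (d + 1) = g at *
    calc a * (b * g * b⁻¹) * a⁻¹ = (a * b) * g * (a * b)⁻¹ := by group
      _ = _ := by rw [hc.eq]; group

/-- Up to conjugation by pure braids, conjugation by a generator permutes the pure generators. -/
theorem conj_pureGen {k i d : ℕ} (hk : k < n - 1) (hn : i + d < n - 1) :
    ∃ p ∈ PureBraidGroup n, ∃ i' d', i' + d' < n - 1 ∧
      sNat n k * pureGen n i d * (sNat n k)⁻¹ = p * pureGen n i' d' * p⁻¹ := by
  have comm : Commute (sNat n k) (pureGen n i d) → ∃ p ∈ PureBraidGroup n, ∃ i' d',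
      i' + d' < n - 1 ∧ sNat n k * pureGen n i d * (sNat n k)⁻¹ = p * pureGen n i' d' * p⁻¹ :=
    fun h => ⟨1, one_mem _, i, d, hn, by rw [h.eq]; group⟩
  by_cases c1 : k + 2 ≤ i ∨ i + d + 2 ≤ k
  · exact comm (commute_pureGen_far c1)
  by_cases c2 : i < k ∧ k < i + d
  · exact comm (commute_pureGen_mid hn c2.1 c2.2)
  rcases lt_trichotomy (k + 1) (i + 1) with c3 | c3 | c3
  · obtain rfl : i = k + 1 := by omega
    -- The generator is already an s_k-conjugate of `pureGen n k (d + 1)`, so a second conjugation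
    -- by s_k amounts to one by the pure braid s_k².
    refine ⟨_, sNat_sq_mem k, k, d + 1, by omega, ?_⟩
    rw [← conj_pureGen_left (by omega)]
    group
  · obtain rfl : k = i := by omega
    rcases d with _ | d
    · exact comm ((Commute.refl _).mul_right (Commute.refl _))
    · exact ⟨1, one_mem _, k + 1, d, by omega, by rw [conj_pureGen_left hn]; group⟩
  · by_cases c4 : k = i + d
    · obtain ⟨e, rfl⟩ : ∃ e, d = e + 1 := ⟨d - 1, by omega⟩
      obtain rfl : k = i + 1 + e := by omega
      refine ⟨_, sNat_sq_mem (i + 1 + e), i, e, by omega, ?_⟩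
      rw [pureGen_succ]
      group
    · obtain rfl : k = i + 1 + d := by omega
      exact ⟨1, one_mem _, i, d + 1, by omega, by rw [pureGen_succ]; group⟩

/-- A homomorphism from `P_n` to an abelian group is determined on the pure generators. -/
theorem hom_pureBraidGroup_eq_one {A : Type*} [CommGroup A] (χ : PureBraidGroup n →* A)
    (h : ∀ i d, i + d < n - 1 → χ ⟨pureGen n i d, pureGen_mem i d⟩ = 1) : χ = 1 := by
  -- The kernel of χ is a priori normalized by P_n only. `conj_pureGen` is what keeps all
  -- B_n-conjugates of the pure generators inside it.
  let K : Subgroup (BraidGroup n) := χ.ker.map (PureBraidGroup n).subtype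
  have hK : ∀ {a} (ha : a ∈ PureBraidGroup n), a ∈ K ↔ χ ⟨a, ha⟩ = 1 := by
    intro a ha
    constructor
    · rintro ⟨b, hb, rfl⟩
      exact hb
    · exact fun h => ⟨⟨a, ha⟩, h, rfl⟩
  have hconj : ∀ {p a}, p ∈ PureBraidGroup n → a ∈ K → p * a * p⁻¹ ∈ K := by
    rintro p _ hp ⟨b, hb, rfl⟩
    exact ⟨⟨p, hp⟩ * b * ⟨p, hp⟩⁻¹, Subgroup.Normal.conj_mem inferInstance _ hb _, rfl⟩
  have key : ∀ g : BraidGroup n, ∀ i d, i + d < n - 1 → g * pureGen n i d * g⁻¹ ∈ K := by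
    intro g
    have hg : g ∈ Subgroup.closure (Set.range (s : Fin (n - 1) → BraidGroup n)) := by
      rw [closure_range_s]; trivial
    have step : ∀ g k, k < n - 1 → (∀ i d, i + d < n - 1 → g * pureGen n i d * g⁻¹ ∈ K) →
        ∀ i d, i + d < n - 1 → (g * sNat n k) * pureGen n i d * (g * sNat n k)⁻¹ ∈ K := by
      intro g k hk hg i d hid
      obtain ⟨p, hp, i', d', hid', hpe⟩ := conj_pureGen hk hid
      have := hconj (Subgroup.Normal.conj_mem inferInstance p hp g) (hg i' d' hid')
      have e : g * sNat n k * pureGen n i d * (g * sNat n k)⁻¹ =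
          g * (sNat n k * pureGen n i d * (sNat n k)⁻¹) * g⁻¹ := by group
      rw [e, hpe]
      convert this using 1
      group
    refine Subgroup.closure_induction_right (p := fun g _ => ∀ i d, i + d < n - 1 →
      g * pureGen n i d * g⁻¹ ∈ K) ?_ ?_ ?_ hg
    · intro i d hid
      rw [one_mul, inv_one, mul_one, hK (pureGen_mem i d)]
      exact h i d hid
    · rintro g _ _ ⟨k, rfl⟩ ih
      have := step g k k.2 ih
      rwa [sNat_of_lt k.2] at this
    · rintro g _ _ ⟨k, rfl⟩ ih i d hid
      have h1 := step g k k.2 ih i d hid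
      -- Inverse letters reduce to positive ones, since g s_k⁻¹ = (g s_k⁻² g⁻¹) (g s_k) with a pure
      -- first factor.
      have h2 := hconj (inv_mem (Subgroup.Normal.conj_mem inferInstance _ (sNat_sq_mem (n := n) k) g)) h1
      rw [sNat_of_lt k.2] at h2
      convert h2 using 1
      simp only [Fin.eta]
      group
  have hle : PureBraidGroup n ≤ K := by
    refine (pureBraidGroup_le_normalClosure n).trans ((Subgroup.closure_le _).2 ?_)
    intro a ha
    obtain ⟨_, ⟨k, rfl⟩, hk⟩ := Group.mem_conjugatesOfSet_iff.1 ha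
    obtain ⟨g, rfl⟩ := isConj_iff.1 hk
    by_cases hk : k < n - 1
    · exact key g k 0 hk
    · simp [sNat_of_le (n := n) (k := k) (by omega), one_mem]
  exact MonoidHom.ext fun a => (hK a.2).1 (hle a.2)

/-! ### Linking numbers -/

/-- The diagonal action of `B_n` on pairs of strands. -/
def pairPerm (n : ℕ) : BraidGroup n →* Equiv.Perm (Fin n × Fin n) where
  toFun a := Equiv.prodCongr (toPerm n a) (toPerm n a)
  map_one' := by ext p <;> simp
  map_mul' a b := by ext p <;> simp

theorem pairPerm_apply (a : BraidGroup n) (p : Fin n × Fin n) :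
    pairPerm n a p = (toPerm n a p.1, toPerm n a p.2) := rfl

/-- The linking cocycle, counting with weight `t` the crossings of a pair of strands. -/
theorem exists_linking_cocycle {A : Type*} [CommGroup A] (n : ℕ) (t : A) :
    ∃ φ : BraidGroup n → Fin n × Fin n → A,
      (∀ a b p, φ (a * b) p = φ a (pairPerm n b p) * φ b p) ∧
      ∀ i p, φ (s i) p = if p.1 = lo i ∧ p.2 = hi i then t else 1 := by
  obtain ⟨φ, h1, h2⟩ := exists_cocycle (pairPerm n)
    (fun i p => if p.1 = lo i ∧ p.2 = hi i then t else 1) (by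
    rintro i j hij ⟨a, b⟩
    have e : lo j = hi i := by simp [lo, hi, hij]
    have n1 : hi j ≠ lo i := by simp [lo, hi, Fin.ext_iff]; omega
    have n2 : hi j ≠ hi i := by simp [hi, Fin.ext_iff]; omega
    have n3 := lo_ne_hi i
    have e1 := Equiv.swap_apply_of_ne_of_ne n1 n2
    have e2 := Equiv.swap_apply_of_ne_of_ne n3 n1.symm
    -- Both sides count the same three ordered pairs, (lo i, hi i), (lo i, hi j) and (hi i, hi j),
    -- in opposite orders.
    simp only [pairPerm_apply, toPerm_s, e, Equiv.swap_apply_eq_iff, Equiv.swap_apply_left,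
      Equiv.swap_apply_right, e1, e2]
    ac_rfl) (by
    rintro i j hij ⟨a, b⟩
    have n1 : lo i ≠ lo j := by simp [lo, Fin.ext_iff]; omega
    have n2 : lo i ≠ hi j := by simp [lo, hi, Fin.ext_iff]; omega
    have n3 : hi i ≠ lo j := by simp [lo, hi, Fin.ext_iff]; omega
    have n4 : hi i ≠ hi j := by simp [hi, Fin.ext_iff]; omega
    simp only [pairPerm_apply, toPerm_s, Equiv.swap_apply_eq_iff,
      Equiv.swap_apply_of_ne_of_ne n1 n2, Equiv.swap_apply_of_ne_of_ne n3 n4,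
      Equiv.swap_apply_of_ne_of_ne n1.symm n3.symm, Equiv.swap_apply_of_ne_of_ne n2.symm n4.symm]
    ac_rfl)
  exact ⟨φ, h1, fun i p => by rw [h2]⟩

theorem pairPerm_of_mem {a : BraidGroup n} (ha : a ∈ PureBraidGroup n) : pairPerm n a = 1 := by
  have : toPerm n a = 1 := ha
  ext p <;> simp [pairPerm_apply, this]

/-- A full twist s_i² counts t once for its pair, in either order, since only one of its two
crossings has the pair in increasing position. Conjugating a pure braid by g merely relabels the
pair, as the contributions of g and g⁻¹ cancel in A. -/
theorem linking_pureGen {A : Type*} [CommGroup A] {t : A} {φ : BraidGroup n → Fin n × Fin n → A}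
    (hφ : ∀ a b p, φ (a * b) p = φ a (pairPerm n b p) * φ b p)
    (hs : ∀ i p, φ (s i) p = if p.1 = lo i ∧ p.2 = hi i then t else 1)
    {i d : ℕ} (hn : i + d < n - 1) (a b : Fin n) :
    φ (pureGen n i d) (a, b) = if ((a : ℕ) = i ∧ (b : ℕ) = i + d + 1) ∨
      ((a : ℕ) = i + d + 1 ∧ (b : ℕ) = i) then t else 1 := by
  have hone : ∀ p, φ 1 p = 1 := fun p => by simpa using hφ 1 1 p
  have hconj : ∀ g q p, q ∈ PureBraidGroup n →
      φ (g * q * g⁻¹) p = φ q ((pairPerm n g)⁻¹ p) := by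
    intro g q p hq
    have h1 := hφ g g⁻¹ p
    rw [mul_inv_cancel, hone, map_inv] at h1
    rw [hφ, hφ, pairPerm_of_mem hq, Equiv.Perm.one_apply, map_inv, mul_right_comm, ← h1, one_mul]
  induction d generalizing a b with
  | zero =>
    have hi' : i < n - 1 := hn
    rw [pureGen, sNat_of_lt hi', hφ, hs, hs, pairPerm_apply, toPerm_s]
    have hne := lo_ne_hi (⟨i, hi'⟩ : Fin (n - 1))
    simp only [Equiv.swap_apply_eq_iff, Equiv.swap_apply_left, Equiv.swap_apply_right]
    simp only [lo, hi, Fin.ext_iff] at hne ⊢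
    grind
  | succ d ih =>
    have hk : i + 1 + d < n - 1 := by omega
    rw [pureGen_succ, hconj _ _ _ (pureGen_mem i d), sNat_of_lt hk, ← map_inv, pairPerm_apply,
      ih (by omega), map_inv, toPerm_s, Equiv.swap_inv]
    congr 1
    simp only [Equiv.swap_apply_def, lo, hi, Fin.ext_iff]
    grind

/-- Pairs of strands `i < j`. -/
abbrev StrandPair (n : ℕ) : Type := {p : Fin n × Fin n // p.1 < p.2}

/-- The pure generator of a pair of strands. -/
def pairGen (p : StrandPair n) : PureBraidGroup n :=
  ⟨pureGen n p.1.1 (p.1.2 - p.1.1 - 1), pureGen_mem _ _⟩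

/-- Pure braids fix every pair, so the linking cocycle at p restricts to a homomorphism. These
homomorphisms are dual to the pure generators. -/
theorem exists_linking_hom {A : Type*} [CommGroup A] (p : StrandPair n) (t : A) :
    ∃ χ : PureBraidGroup n →* A, ∀ q, χ (pairGen q) = if q = p then t else 1 := by
  obtain ⟨φ, hφ, hs⟩ := exists_linking_cocycle n t
  refine ⟨⟨⟨fun a => φ a p.1, by simpa using hφ 1 1 p.1⟩, fun a b => ?_⟩, fun q => ?_⟩
  · have := hφ a b p.1
    rwa [pairPerm_of_mem b.2, Equiv.Perm.one_apply] at this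
  · obtain ⟨⟨a, b⟩, hab⟩ := p
    obtain ⟨⟨c, d⟩, hcd⟩ := q
    have hab : (a : ℕ) < b := hab
    have hcd : (c : ℕ) < d := hcd
    refine (linking_pureGen hφ hs (i := c) (d := d - c - 1) (by omega) a b).trans ?_
    congr 1
    simp only [Subtype.mk.injEq, Prod.mk.injEq, Fin.ext_iff, eq_iff_iff]
    omega

/-- `Hom(P_n, A) ≃ A^{n(n-1)/2}` for abelian `A`, by evaluation at the pure generators. -/
noncomputable def homPureEquiv (n : ℕ) (A : Type*) [CommGroup A] :
    (PureBraidGroup n →* A) ≃* (StrandPair n → A) :=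
  MulEquiv.ofBijective
    { toFun := fun χ p => χ (pairGen p)
      map_one' := rfl
      map_mul' := fun _ _ => rfl : (PureBraidGroup n →* A) →* (StrandPair n → A) } <| by
    constructor
    · rw [injective_iff_map_eq_one]
      intro χ hχ
      refine hom_pureBraidGroup_eq_one χ fun i d hid => ?_
      have := congrFun hχ ⟨(⟨i, by omega⟩, ⟨i + d + 1, by omega⟩), by simp [Fin.lt_def]⟩
      have e : i + d + 1 - i - 1 = d := by omega
      simpa [pairGen, e] using this
    · intro t
      choose χ hχ using fun p => exists_linking_hom (A := A) (n := n) p (t p)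
      refine ⟨∏ p, χ p, funext fun q => ?_⟩
      change (∏ p, χ p) (pairGen q) = t q
      rw [MonoidHom.finsetProd_apply]
      simp [hχ]

theorem card_strandPair (n : ℕ) : Fintype.card (StrandPair n) = n * (n - 1) / 2 := by
  let e : StrandPair n ≃ Σ b : Fin n, Fin b :=
    { toFun := fun p => ⟨p.1.2, ⟨p.1.1, p.2⟩⟩
      invFun := fun p => ⟨(⟨p.2, p.2.2.trans p.1.2⟩, p.1), p.2.2⟩
      left_inv := fun _ => rfl
      right_inv := fun _ => rfl }
  rw [Fintype.card_congr e, Fintype.card_sigma]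
  simp only [Fintype.card_fin]
  rw [Fin.sum_univ_eq_sum_range (fun i => i), Finset.sum_range_id]

/-! ### Cohomology of the pure braid group -/

theorem artinPure_hom_apply (a : PureBraidGroup n) (f : FreeGroup (Fin n) →* Circle)
    (y : FreeGroup (Fin n)) : f (artinPure n a y) = f y := by
  have : f.comp (artinPure n a).toMonoidHom = f := by
    refine FreeGroup.ext_hom _ _ fun j => ?_
    have h : toPerm n a = 1 := a.2
    have := hom_artin_apply a.1 f j
    rwa [h, Equiv.Perm.one_apply] at this
  exact DFunLike.congr_fun this y

theorem B1_artinPure : B1 (artinPure n) = ⊥ := by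
  refine (Subgroup.eq_bot_iff_forall _).2 ?_
  rintro φ ⟨f, hf⟩
  refine Subtype.ext (funext fun a => MonoidHom.ext fun y => ?_)
  rw [hf, artinPure_hom_apply, mul_inv_cancel]
  rfl

/-- Cocycles on `P_n` are homomorphisms. -/
noncomputable def Z1PureEquiv (n : ℕ) :
    Z1 (artinPure n) ≃* (PureBraidGroup n →* (FreeGroup (Fin n) →* Circle)) where
  toFun φ := MonoidHom.mk' φ.1 fun a b => MonoidHom.ext fun y => by
    rw [φ.2 a b y, artinPure_hom_apply]
    rfl
  invFun χ := ⟨χ, fun a b y => by rw [artinPure_hom_apply, map_mul]; rfl⟩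
  left_inv _ := rfl
  right_inv _ := rfl
  map_mul' _ _ := rfl

/-- `Hom(F_n, A) ≃ A^n`. -/
def freeGroupHomEquiv (ι A : Type*) [CommGroup A] : (FreeGroup ι →* A) ≃* (ι → A) where
  toEquiv := FreeGroup.lift.symm
  map_mul' _ _ := rfl

theorem toH1_artinPure_bijective : Function.Bijective (toH1 (artinPure n)) := by
  refine ⟨?_, QuotientGroup.mk'_surjective _⟩
  rw [← MonoidHom.ker_eq_bot_iff, toH1, QuotientGroup.ker_mk', B1_artinPure]

theorem nonempty_H1_artinPure (n : ℕ) :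
    Nonempty (H1 (artinPure n) ≃* (Fin (n * (n - 1) / 2 * n) → Circle)) := by
  have hcard : Fintype.card (StrandPair n × Fin n) = n * (n - 1) / 2 * n := by
    rw [Fintype.card_prod, card_strandPair, Fintype.card_fin]
  let E₁ : H1 (artinPure n) ≃* Z1 (artinPure n) :=
    (MulEquiv.ofBijective _ toH1_artinPure_bijective).symm
  let E₂ : (StrandPair n → (FreeGroup (Fin n) →* Circle)) ≃* (StrandPair n → Fin n → Circle) :=
    MulEquiv.piCongrRight fun _ => freeGroupHomEquiv (Fin n) Circle
  let E₃ : (StrandPair n → Fin n → Circle) ≃* (StrandPair n × Fin n → Circle) :=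
    { toEquiv := (Equiv.curry _ _ _).symm
      map_mul' := fun _ _ => rfl }
  let E₄ : (StrandPair n × Fin n → Circle) ≃* (Fin (n * (n - 1) / 2 * n) → Circle) :=
    { toEquiv := Equiv.arrowCongr (Fintype.equivFinOfCardEq hcard) (Equiv.refl _)
      map_mul' := fun _ _ => rfl }
  exact ⟨E₁.trans <| (Z1PureEquiv n).trans <| (homPureEquiv n _).trans <|
    E₂.trans <| E₃.trans E₄⟩

end Pure

end ArtinBraid

theorem mainTheorem4 :
    -- `H¹(B_2, Hom(F_2, 𝕋)) ≃ 𝕋` through `μ₁`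
    (∃ Φ : ArtinBraid.H1 (ArtinBraid.artin 2) ≃* Circle,
      ∀ (φ : ArtinBraid.Z1 (ArtinBraid.artin 2)) (i : Fin (2 - 1)),
        φ.1 (ArtinBraid.s i) (ArtinBraid.x (ArtinBraid.lo i)) *
            φ.1 (ArtinBraid.s i) (ArtinBraid.x (ArtinBraid.hi i)) =
          Φ (ArtinBraid.toH1 (ArtinBraid.artin 2) φ)) ∧
    -- `H¹(B_n, Hom(F_n, 𝕋)) ≃ 𝕋²` through `(μ₁, μ₂)` for `n ≥ 3`
    (∀ n : ℕ, 3 ≤ n →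
      ∃ Φ : ArtinBraid.H1 (ArtinBraid.artin n) ≃* Circle × Circle,
        ∀ (φ : ArtinBraid.Z1 (ArtinBraid.artin n)) (i : Fin (n - 1)),
          φ.1 (ArtinBraid.s i) (ArtinBraid.x (ArtinBraid.lo i)) *
              φ.1 (ArtinBraid.s i) (ArtinBraid.x (ArtinBraid.hi i)) =
            (Φ (ArtinBraid.toH1 (ArtinBraid.artin n) φ)).1 ∧
          ∀ j : Fin n, j ≠ ArtinBraid.lo i → j ≠ ArtinBraid.hi i →
            φ.1 (ArtinBraid.s i) (ArtinBraid.x j) =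
              (Φ (ArtinBraid.toH1 (ArtinBraid.artin n) φ)).2) ∧
    -- the pure braid groups
    (∀ n : ℕ, 2 ≤ n →
      -- `P_n` acts trivially on `Hom(F_n, 𝕋)`
      (∀ (a : ArtinBraid.PureBraidGroup n) (f : FreeGroup (Fin n) →* Circle)
        (y : FreeGroup (Fin n)), f (ArtinBraid.artinPure n a y) = f y) ∧
      -- `H¹ = Z¹`
      ArtinBraid.B1 (ArtinBraid.artinPure n) = ⊥ ∧
      Function.Bijective (ArtinBraid.toH1 (ArtinBraid.artinPure n)) ∧
      -- `Z¹ = Hom(P_n, Hom(F_n, 𝕋))`, as groups of functions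
      (∃ E : ArtinBraid.Z1 (ArtinBraid.artinPure n) ≃*
          (ArtinBraid.PureBraidGroup n →* (FreeGroup (Fin n) →* Circle)),
        ∀ (φ : ArtinBraid.Z1 (ArtinBraid.artinPure n)) (a : ArtinBraid.PureBraidGroup n),
          E φ a = φ.1 a) ∧
      Nonempty (ArtinBraid.H1 (ArtinBraid.artinPure n) ≃*
        (Fin (n * (n - 1) / 2 * n) → Circle))) := by
  refine ⟨ArtinBraid.H1_artin_two, fun n hn => ArtinBraid.H1_artin hn, fun n _ => ?_⟩
  exact ⟨ArtinBraid.artinPure_hom_apply, ArtinBraid.B1_artinPure,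
    ArtinBraid.toH1_artinPure_bijective, ⟨ArtinBraid.Z1PureEquiv n, fun φ a => rfl⟩,
    ArtinBraid.nonempty_H1_artinPure n⟩
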